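/- **Setting.** Graphs are finite, simple and undirected, with node features $X_v\in\mathbb R^F$. Fix one of the two conventions for neighbourhoods, $\mathcal N(v)=\{w : \mathrm{dist}(v,w)\le 1\}$ (which contains $v$) or $\mathcal N(v)=\{w : w \text{ adjacent to } v\}$; everything below holds for both. For a hash function $\mathcal H:\mathcal V\to[n]$ the Bloom signature $\mathbf s_v\in\{0,1\}^n$ of $\mathcal N(v)$ has $\mathbf s_v[j]=1$ iff $\mathcal H(w)=j$ for some $w\in\mathcal N(v)$. Write $\|$ for concatenation. A *standard MPNN* computes $\mathbf h^{(0)}_v=X_v$, $\mathbf h^{(l)}_v=\sigma^{(l)}\big(\mathbf h^{(l-1)}_v,\mathrm{AGG}^{(l)}\{\!\!\{\phi^{(l)}(\mathbf h^{(l-1)}_v,\mathbf h^{(l-1)}_w) : w\in\mathcal N(v)\}\!\!\}\big)$ for $l=1,\dots,L$, and scores the pair $(u,v)$ by $\mathrm{sigmoid}(\rho(\mathbf h_u\circ\mathbf h_v))$ with a decoder $\circ$ and a real-valued readout function $\rho$. An *MPNN with Bloom signatures* computes $\mathbf h^{(0)}_v=X_v$ and $$\mathbf h^{(l)}_v=\sigma^{(l)}\big(\mathbf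 h^{(l-1)}_v,\mathrm{AGG}^{(l)}\{\!\!\{\phi^{(l)}(\mathbf h^{(l-1)}_w,\mathbf h^{(l-1)}_v,\mathbf e_{w,v}) : w\in\mathcal N(v)\}\!\!\}\big),\qquad \mathbf e_{w,v}=\psi(\mathbf s_w\|\mathbf s_v),$$ has the pair representations $\rho\big((\mathbf h_u\circ\mathbf h_v)\,\|\,\hat S(\mathbf s_u\|\mathbf s_v)\big)$, and scores the pair $(u,v)$ by the sigmoid of its (then real-valued) pair representation; for graph-level output, the representations of all ordered node pairs are pooled and passed through a further real-valued readout. Such a model is called *neural* if $\phi^{(l)},\sigma^{(l)},\psi,\hat S,\rho$ and the graph-level readout (those which the model has) are ReLU multilayer perceptrons, each $\mathrm{AGG}^{(l)}$ and the pooling is a sum, mean or entrywise maximum, and $\circ$ is the dot product, Hadamard product or concatenation; without this word these are arbitrary functions. **Proposition.** Let $n,F\ge 0$. 1. *(At least as expressive as standard MPNNs and 1-WL.)* For every standard MPNN there is an MPNN with Bloom signatures of length $n$, neural if the given MPNN is neural, that gives the same scores to all node pairs of all graphs, for every $\mathcal H$. Moreover, if after some number of rounds 1-WL (with initial colours $X_v$)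 gives different ordered pairs of colours to the pairs $(u,v)$ in $\mathcal G$ and $(u',v')$ in $\mathcal G'$, then some neural MPNN with Bloom signatures gives different scores to them, for all hash functions on $\mathcal G$ and $\mathcal G'$. 2. *(Strictly more expressive.)* Let $\mathcal G$ be the 3-regular graph on $v_1,\dots,v_8$ with edges $v_1v_2,v_1v_7,v_1v_8,v_2v_3,v_2v_4,v_3v_4,v_3v_6,v_4v_5,v_5v_6,v_5v_8,v_6v_7,v_7v_8$, with all node features equal. There is an automorphism of $\mathcal G$ mapping $v_4$ to $v_7$ (and trivially one mapping $v_1$ to $v_1$), but none mapping $(v_1,v_4)$ to $(v_1,v_7)$. Neither 1-WL nor any standard MPNN separates $(v_1,v_4)$ from $(v_1,v_7)$. But there is a neural MPNN with Bloom signatures of length $n$ such that, for all feature values and all injective (collision-free) hash functions $\mathcal H,\mathcal H':\mathcal V\to[n]$, the score of $(v_1,v_4)$ under $\mathcal H$ differs from the score of $(v_1,v_7)$ under $\mathcal H'$. 3. *(Not less powerful than 3-WL.)* The Shrikhande graph and the $4\times4$ Rook's graph are not isomorphic, and the (non-folklore) 3-WL algorithm does not distinguish them. But there is a neural MPNN with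 Bloom signatures of length $n$ and graph-level readout whose outputs on the two graphs (with all node features equal to one common vector) differ, for all values of that vector and all injective hash functions to $[n]$ on the two graphs. -/

import Mathlib

noncomputable section

namespace BloomMPNN

/-- Real vectors of length `d`; concatenation `x || y` is `Fin.append x y`. -/
abbrev Vec (d : ℕ) := Fin d → ℝ

section Components

/-- Entrywise ReLU. -/
def relu {d : ℕ} (x : Vec d) : Vec d := fun i => max (x i) 0

/-- The functions computed by multilayer perceptrons with ReLU activations (any depth, any widths,
linear output layer). -/
inductive IsMLP {a : ℕ} : {b : ℕ} → (Vec a → Vec b) → Prop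
  | affine {b : ℕ} (W : Matrix (Fin b) (Fin a) ℝ) (c : Vec b) :
      IsMLP (fun x => W.mulVec x + c)
  | layer {b b' : ℕ} {f : Vec a → Vec b} (hf : IsMLP f) (W : Matrix (Fin b') (Fin b) ℝ)
      (c : Vec b') : IsMLP (fun x => W.mulVec (relu (f x)) + c)

/-- The usual permutation-invariant aggregations: sum, mean and entrywise maximum. -/
inductive IsAggregator {m : ℕ} : (Multiset (Vec m) → Vec m) → Prop
  | sum : IsAggregator (fun s => s.sum)
  | mean : IsAggregator (fun s => (s.card : ℝ)⁻¹ • s.sum)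
  | max : IsAggregator (fun s i => sSup {y | ∃ x ∈ s, x i = y})

/-- The usual decoders for link prediction: dot product, Hadamard product and concatenation. -/
inductive IsDecoder {d : ℕ} : {k : ℕ} → (Vec d → Vec d → Vec k) → Prop
  | dot : IsDecoder (fun x y => (fun _ => x ⬝ᵥ y : Vec 1))
  | hadamard : IsDecoder (fun x y => x * y)
  | concat : IsDecoder (fun x y => Fin.append x y)

end Components

section Graphs

variable {V V' : Type} [Fintype V] [Fintype V']

open Classical in
/-- The neighbourhood `N(v)`. With `loops = true` it consists of all nodes at shortest path distance
at most 1 from `v`, including `v` itself; with `loops = false` the node `v` is left out. -/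
def nbhd (loops : Bool) (G : SimpleGraph V) (v : V) : Finset V :=
  Finset.univ.filter fun w => G.Adj v w ∨ (loops = true ∧ w = v)

open Classical in
/-- The Bloom signature `s_v ∈ {0,1}^n` of `N(v)` for the hash function `H : V → [n]`. -/
def bloomSig {n : ℕ} (loops : Bool) (G : SimpleGraph V) (H : V → Fin n) (v : V) : Vec n :=
  fun j => if ∃ w ∈ nbhd loops G v, H w = j then 1 else 0

/-- `u ∼_G v` for nodes. -/
def AutNodes (G : SimpleGraph V) (u v : V) : Prop := ∃ π : G ≃g G, π u = v

/-- `(u₁, v₁) ∼_G (u₂, v₂)` for node pairs. -/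
def AutPairs (G : SimpleGraph V) (e₁ e₂ : V × V) : Prop :=
  ∃ π : G ≃g G, π e₁.1 = e₂.1 ∧ π e₁.2 = e₂.2

/-! ### Weisfeiler-Leman algorithms -/

/-- Colours after `t` rounds of 1-WL; the initial colours are the node features. -/
def WL1Color (F : ℕ) : ℕ → Type
  | 0 => Vec F
  | t + 1 => WL1Color F t × Multiset (WL1Color F t)

open Classical in
/-- Colour refinement (1-WL). -/
def wl1 {F : ℕ} (G : SimpleGraph V) (X : V → Vec F) : (t : ℕ) → V → WL1Color F t
  | 0, v => X v
  | t + 1, v =>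
      (wl1 G X t v, (Finset.univ.filter fun w => G.Adj v w).val.map fun w => wl1 G X t w)

/-- 1-WL gives different colours to the two ordered node pairs (of possibly different graphs). -/
def WL1Separates {F : ℕ} (G : SimpleGraph V) (X : V → Vec F) (e : V × V)
    (G' : SimpleGraph V') (X' : V' → Vec F) (e' : V' × V') : Prop :=
  ∃ t, (wl1 G X t e.1, wl1 G X t e.2) ≠ (wl1 G' X' t e'.1, wl1 G' X' t e'.2)

/-- Colours of `k`-tuples after `t` rounds of `k`-WL. -/
def WLColor (k : ℕ) : ℕ → Type
  | 0 => Fin k → Fin k → Prop × Prop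
  | t + 1 => WLColor k t × (Fin k → Multiset (WLColor k t))

/-- The `k`-dimensional Weisfeiler-Leman algorithm on `k`-tuples, `k ≥ 2` (the standard,
non-folklore version). The initial colour is the isomorphism type of the ordered induced subgraph.
In each round, for each position `i`, the multiset of the colours of the tuples
that arise by replacing the `i`-th entry is added. -/
def wl (k : ℕ) (G : SimpleGraph V) : (t : ℕ) → (Fin k → V) → WLColor k t
  | 0, a => fun i j => (a i = a j, G.Adj (a i) (a j))
  | t + 1, a =>
      (wl k G t a, fun i => Finset.univ.val.map fun w => wl k G t (Function.update a i w))

open Classical in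
/-- `k`-WL does not distinguish the two graphs: after any number of rounds, the multisets of
colours of all `k`-tuples agree. -/
def WLEquiv (k : ℕ) (G : SimpleGraph V) (G' : SimpleGraph V') : Prop :=
  ∀ t, (Finset.univ : Finset (Fin k → V)).val.map (wl k G t) =
    (Finset.univ : Finset (Fin k → V')).val.map (wl k G' t)

end Graphs

/-! ### Standard MPNN -/

/-- A message passing layer:
`h_v' = upd (h_v || agg {{ phi (h_v || h_w) | w ∈ N(v) }})`. -/
structure MPLayer (d d' : ℕ) where
  m : ℕ
  phi : Vec (d + d) → Vec m
  agg : Multiset (Vec m) → Vec m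
  upd : Vec (d + m) → Vec d'

/-- The layer is built from MLPs and a usual aggregation. -/
def MPLayer.IsNeural {d d' : ℕ} (l : MPLayer d d') : Prop :=
  IsMLP l.phi ∧ IsAggregator l.agg ∧ IsMLP l.upd

/-- A finite sequence of message passing layers, from node features in `ℝ^F` to `ℝ^d`. -/
inductive MPStack (F : ℕ) : ℕ → Type
  | input : MPStack F F
  | layer {d d' : ℕ} (prev : MPStack F d) (l : MPLayer d d') : MPStack F d'

def MPStack.IsNeural {F : ℕ} : {d : ℕ} → MPStack F d → Prop
  | _, .input => True
  | _, .layer prev l => prev.IsNeural ∧ l.IsNeural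

/-- The node representations `h_v`. -/
def MPStack.eval {F : ℕ} {V : Type} [Fintype V] (loops : Bool) (G : SimpleGraph V)
    (X : V → Vec F) : {d : ℕ} → MPStack F d → V → Vec d
  | _, .input, v => X v
  | _, .layer prev l, v =>
      l.upd (Fin.append (prev.eval loops G X v)
        (l.agg ((nbhd loops G v).val.map fun w =>
          l.phi (Fin.append (prev.eval loops G X v) (prev.eval loops G X w)))))

/-- A standard MPNN for link prediction: message passing layers, a decoder and a head. -/
structure MPNN (F : ℕ) where
  d : ℕ
  layers : MPStack F d
  k : ℕ
  dec : Vec d → Vec d → Vec k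
  head : Vec k → Vec 1

/-- All learnable parts are MLPs; aggregations and decoder are usual ones. -/
def MPNN.IsNeural {F : ℕ} (M : MPNN F) : Prop :=
  M.layers.IsNeural ∧ IsDecoder M.dec ∧ IsMLP M.head

/-- The predicted likelihood `sigmoid (head (h_u ∘ h_v))` of the link `(u, v)`. -/
def MPNN.score {F : ℕ} (M : MPNN F) {V : Type} [Fintype V] (loops : Bool) (G : SimpleGraph V)
    (X : V → Vec F) (u v : V) : ℝ :=
  Real.sigmoid (M.head (M.dec (M.layers.eval loops G X u) (M.layers.eval loops G X v)) 0)

/-! ### MPNN with Bloom signatures -/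

/-- A message passing layer with edge features in `ℝ^e`:
`h_v' = upd (h_v || agg {{ phi (h_w || h_v || e_{w,v}) | w ∈ N(v) }})`. -/
structure BloomLayer (e d d' : ℕ) where
  m : ℕ
  phi : Vec (d + d + e) → Vec m
  agg : Multiset (Vec m) → Vec m
  upd : Vec (d + m) → Vec d'

def BloomLayer.IsNeural {e d d' : ℕ} (l : BloomLayer e d d') : Prop :=
  IsMLP l.phi ∧ IsAggregator l.agg ∧ IsMLP l.upd

inductive BloomStack (e F : ℕ) : ℕ → Type
  | input : BloomStack e F F
  | layer {d d' : ℕ} (prev : BloomStack e F d) (l : BloomLayer e d d') : BloomStack e F d'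

def BloomStack.IsNeural {e F : ℕ} : {d : ℕ} → BloomStack e F d → Prop
  | _, .input => True
  | _, .layer prev l => prev.IsNeural ∧ l.IsNeural

/-- The node representations `h_v` for given edge features `E w v = e_{w,v}`. -/
def BloomStack.eval {e F : ℕ} {V : Type} [Fintype V] (loops : Bool) (G : SimpleGraph V)
    (E : V → V → Vec e) (X : V → Vec F) : {d : ℕ} → BloomStack e F d → V → Vec d
  | _, .input, v => X v
  | _, .layer prev l, v =>
      l.upd (Fin.append (prev.eval loops G E X v)
        (l.agg ((nbhd loops G v).val.map fun w =>
          l.phi (Fin.append (Fin.append (prev.eval loops G E X w) (prev.eval loops G E X v))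
            (E w v)))))

/-- An MPNN with Bloom signatures of length `n` and node pair representations in `ℝ^r`:
`psi` is the encoder of the edge features `e_{w,v} = psi (s_w || s_v)`, and `sHat` computes the
pairwise structural features from `s_u || s_v`. -/
structure BloomNet (n F r : ℕ) where
  e : ℕ
  psi : Vec (n + n) → Vec e
  d : ℕ
  layers : BloomStack e F d
  k : ℕ
  dec : Vec d → Vec d → Vec k
  p : ℕ
  sHat : Vec (n + n) → Vec p
  head : Vec (k + p) → Vec r

/-- All learnable parts are MLPs; aggregations and decoder are usual ones. -/
def BloomNet.IsNeural {n F r : ℕ} (M : BloomNet n F r) : Prop :=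
  IsMLP M.psi ∧ M.layers.IsNeural ∧ IsDecoder M.dec ∧ IsMLP M.sHat ∧ IsMLP M.head

section BloomEval

variable {n F : ℕ} {V : Type} [Fintype V]

/-- The node representations `h_v`. -/
def BloomNet.node {r : ℕ} (M : BloomNet n F r) (loops : Bool) (G : SimpleGraph V) (X : V → Vec F)
    (H : V → Fin n) (v : V) : Vec M.d :=
  M.layers.eval loops G
    (fun w v => M.psi (Fin.append (bloomSig loops G H w) (bloomSig loops G H v))) X v

/-- The node pair representation `head (h_u ∘ h_v || Ŝ(u, v))`. -/
def BloomNet.pair {r : ℕ} (M : BloomNet n F r) (loops : Bool) (G : SimpleGraph V) (X : V → Vec F)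
    (H : V → Fin n) (u v : V) : Vec r :=
  M.head (Fin.append (M.dec (M.node loops G X H u) (M.node loops G X H v))
    (M.sHat (Fin.append (bloomSig loops G H u) (bloomSig loops G H v))))

/-- The predicted likelihood `sigmoid (head (h_u ∘ h_v || Ŝ(u, v)))` of the link `(u, v)`. -/
def BloomNet.score (M : BloomNet n F 1) (loops : Bool) (G : SimpleGraph V) (X : V → Vec F)
    (H : V → Fin n) (u v : V) : ℝ :=
  Real.sigmoid (M.pair loops G X H u v 0)

end BloomEval

/-- An MPNN with Bloom signatures with a graph-level readout: the representations of all
ordered node pairs are pooled and passed to `readout`. -/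
structure BloomGraphNet (n F : ℕ) where
  r : ℕ
  net : BloomNet n F r
  pool : Multiset (Vec r) → Vec r
  readout : Vec r → Vec 1

def BloomGraphNet.IsNeural {n F : ℕ} (M : BloomGraphNet n F) : Prop :=
  M.net.IsNeural ∧ IsAggregator M.pool ∧ IsMLP M.readout

def BloomGraphNet.output {n F : ℕ} {V : Type} [Fintype V] (M : BloomGraphNet n F) (loops : Bool)
    (G : SimpleGraph V) (X : V → Vec F) (H : V → Fin n) : ℝ :=
  M.readout (M.pool ((Finset.univ : Finset (V × V)).val.map
    fun q => M.net.pair loops G X H q.1 q.2)) 0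

/-! ### The graphs -/

/-- The 3-regular graph on eight nodes; `v_i` is the element `i - 1` of `Fin 8`. -/
def cubicGraph : SimpleGraph (Fin 8) :=
  SimpleGraph.fromRel fun a b => (a, b) ∈ ([(0, 1), (0, 6), (0, 7), (1, 2), (1, 3), (2, 3), (2, 5),
    (3, 4), (4, 5), (4, 7), (5, 6), (6, 7)] : List (Fin 8 × Fin 8))

/-- The Shrikhande graph: the Cayley graph of `ℤ/4 × ℤ/4` with connection set
`{±(1,0), ±(0,1), ±(1,1)}`. -/
def shrikhande : SimpleGraph (ZMod 4 × ZMod 4) :=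
  SimpleGraph.fromRel fun a b => b - a ∈ ([(1, 0), (0, 1), (1, 1)] : List (ZMod 4 × ZMod 4))

/-- The 4 × 4 Rook's graph: two different squares are adjacent if they share a row or a column. -/
def rook : SimpleGraph (Fin 4 × Fin 4) :=
  SimpleGraph.fromRel fun a b => a.1 = b.1 ∨ a.2 = b.2

end BloomMPNN

end

open BloomMPNN

/-!
A bounded-depth message passing network computes a function of the 1-WL colours. Conversely, ReLU
networks interpolate arbitrary functions on finite sets, and mapping the elements of a finite set
to distinct unit vectors makes the sum over a multiset injective, so that a network which sees only
the node features recovers the 1-WL colours on two given graphs.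

The power of Bloom signatures comes from identifiable nodes. If no neighbourhood is contained in
another one, then `u` is the only node that lies in `N(w)` for all `w ∈ N(u)`, so that the
conjunction of the signatures of these `w` is the unit vector at the hash value of `u`. Its inner
product with the signature of `v` decides whether `u ∈ N(v)`, and its outer products with the
signature of `u`, summed over `u`, give the adjacency matrix relabelled by the hash values, which
determines the graph up to isomorphism. Only finitely many such matrices arise from two given
graphs, so a readout that interpolates separates the graphs if they are not isomorphic.

In a strongly regular graph the number of one-point extensions of each type of a pair depends only
on the type of the pair. Hence the 3-WL colour of a triple depends only on its isomorphism type and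
the parameters, and strongly regular graphs with the same parameters have equally many triples of
each type.
-/

noncomputable section

namespace BloomMPNN

/-! ### ReLU networks -/

section MLP

variable {a b c : ℕ}

/-- The linear map `x ↦ L x || M x`. -/
def appendLinearMap (L : Vec a →ₗ[ℝ] Vec b) (M : Vec a →ₗ[ℝ] Vec c) : Vec a →ₗ[ℝ] Vec (b + c) where
  toFun x := Fin.append (L x) (M x)
  map_add' x y := by
    ext i
    refine Fin.addCases (fun i => ?_) (fun i => ?_) i <;> simp
  map_smul' r x := by
    ext i
    refine Fin.addCases (fun i => ?_) (fun i => ?_) i <;> simp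

/-- The first block of a concatenated vector. -/
def leftBlock (b c : ℕ) : Vec (b + c) →ₗ[ℝ] Vec b := LinearMap.funLeft ℝ ℝ (Fin.castAdd c)

/-- The second block of a concatenated vector. -/
def rightBlock (b c : ℕ) : Vec (b + c) →ₗ[ℝ] Vec c := LinearMap.funLeft ℝ ℝ (Fin.natAdd b)

@[simp]
theorem appendLinearMap_apply (L : Vec a →ₗ[ℝ] Vec b) (M : Vec a →ₗ[ℝ] Vec c) (x : Vec a) :
    appendLinearMap L M x = Fin.append (L x) (M x) :=
  rfl

@[simp]
theorem leftBlock_append (x : Vec b) (y : Vec c) : leftBlock b c (Fin.append x y) = x :=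
  funext fun i => Fin.append_left x y i

@[simp]
theorem rightBlock_append (x : Vec b) (y : Vec c) : rightBlock b c (Fin.append x y) = y :=
  funext fun i => Fin.append_right x y i

theorem append_add_append (x x' : Vec b) (y y' : Vec c) :
    Fin.append x y + Fin.append x' y' = Fin.append (x + x') (y + y') := by
  ext i
  refine Fin.addCases (fun i => ?_) (fun i => ?_) i <;> simp

theorem relu_append (x : Vec b) (y : Vec c) :
    relu (Fin.append x y) = Fin.append (relu x) (relu y) := by
  ext i
  refine Fin.addCases (fun i => ?_) (fun i => ?_) i <;> simp [relu]

theorem relu_sub_relu_neg (x : Vec b) : relu x - relu (-x) = x :=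
  funext fun i => max_zero_sub_max_neg_zero_eq_self (x i)

namespace IsMLP

theorem linear {f : Vec a → Vec b} (hf : IsMLP f) (L : Vec b →ₗ[ℝ] Vec c) (w : Vec c) :
    IsMLP fun x => L (f x) + w := by
  have hL (y : Vec b) : L y = (LinearMap.toMatrix' L).mulVec y :=
    (LinearMap.toMatrix'_mulVec L y).symm
  cases hf with
  | affine U u =>
    convert affine (LinearMap.toMatrix' L * U) (L u + w) using 2 with x
    rw [map_add, hL, hL, Matrix.mulVec_mulVec, add_assoc]
  | layer hf U u =>
    convert layer hf (LinearMap.toMatrix' L * U) (L u + w) using 2 with x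
    rw [map_add, hL, hL, Matrix.mulVec_mulVec, add_assoc]

theorem map {f : Vec a → Vec b} (hf : IsMLP f) (L : Vec b →ₗ[ℝ] Vec c) :
    IsMLP fun x => L (f x) := by
  simpa only [add_zero] using hf.linear L 0

theorem id : IsMLP fun x : Vec a => x := by
  simpa only [Matrix.one_mulVec, add_zero] using affine (1 : Matrix (Fin a) (Fin a) ℝ) 0

theorem const (w : Vec b) : IsMLP fun _ : Vec a => w := by
  simpa only [Matrix.zero_mulVec, zero_add] using affine (0 : Matrix (Fin b) (Fin a) ℝ) w

theorem comp {g : Vec b → Vec c} {f : Vec a → Vec b} (hg : IsMLP g) (hf : IsMLP f) :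
    IsMLP fun x => g (f x) := by
  induction hg with
  | affine W w => exact hf.linear W.mulVecLin w
  | layer _ W w ih => exact layer ih W w

theorem relu {f : Vec a → Vec b} (hf : IsMLP f) : IsMLP fun x => BloomMPNN.relu (f x) := by
  simpa only [Matrix.one_mulVec, add_zero] using layer hf (1 : Matrix (Fin b) (Fin b) ℝ) 0

theorem append_rightBlock {f : Vec a → Vec b} (hf : IsMLP f) :
    IsMLP fun x => Fin.append (f (leftBlock a c x)) (rightBlock a c x) := by
  induction hf with
  | affine W w =>
    convert linear id (appendLinearMap (W.mulVecLin ∘ₗ leftBlock a c) (rightBlock a c))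
      (Fin.append w 0) using 2
    simp [append_add_append]
  | @layer b b' f _ W w ih =>
    -- The ReLU of this layer is undone on the second block `y` by `y = relu y - relu (-y)`.
    have split := ih.map
      (appendLinearMap (leftBlock b c) (appendLinearMap (rightBlock b c) (-rightBlock b c)))
    convert split.relu.linear (appendLinearMap (W.mulVecLin ∘ₗ leftBlock b (c + c))
      ((leftBlock c c - rightBlock c c) ∘ₗ rightBlock b (c + c))) (Fin.append w 0) using 2
    simp [append_add_append, relu_append, relu_sub_relu_neg]

theorem append {f : Vec a → Vec b} {g : Vec a → Vec c} (hf : IsMLP f) (hg : IsMLP g) :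
    IsMLP fun x => Fin.append (f x) (g x) := by
  have hfx : IsMLP fun x => Fin.append (f x) x := by
    simpa using hf.append_rightBlock.comp (id.map (appendLinearMap .id .id))
  have hxf : IsMLP fun x => Fin.append x (f x) := by
    simpa using hfx.map (appendLinearMap (rightBlock b a) (leftBlock b a))
  have hgf : IsMLP fun x => Fin.append (g x) (f x) := by
    simpa using hg.append_rightBlock.comp hxf
  simpa using hgf.map (appendLinearMap (rightBlock c b) (leftBlock c b))

end IsMLP

/-- Real-valued functions computed by an MLP. -/
def IsScalarMLP (f : Vec a → ℝ) : Prop := IsMLP fun x (_ : Fin 1) => f x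

theorem IsMLP.pi {f : Vec a → Vec b} (hf : ∀ i, IsScalarMLP fun x => f x i) : IsMLP f := by
  induction b with
  | zero => exact Subsingleton.elim (fun _ => 0) f ▸ const 0
  | succ b ih =>
    convert (ih fun i => hf i.castSucc).append (hf (Fin.last b)) using 2 with x
    rw [Fin.append_right_eq_snoc]
    exact (Fin.snoc_init_self (f x)).symm

theorem IsMLP.coord {f : Vec a → Vec b} (hf : IsMLP f) (i : Fin b) : IsScalarMLP fun x => f x i :=
  hf.map (LinearMap.funLeft ℝ ℝ fun _ => i)

namespace IsScalarMLP

variable {f g : Vec a → ℝ}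

theorem eval (i : Fin a) : IsScalarMLP fun x => x i :=
  IsMLP.id.coord i

theorem const (r : ℝ) : IsScalarMLP fun _ : Vec a => r :=
  IsMLP.const fun _ => r

theorem add (hf : IsScalarMLP f) (hg : IsScalarMLP g) : IsScalarMLP fun x => f x + g x := by
  simpa only [IsScalarMLP, LinearMap.add_apply, leftBlock_append, rightBlock_append, Pi.add_def]
    using (IsMLP.append hf hg).map (leftBlock 1 1 + rightBlock 1 1)

theorem const_mul (hf : IsScalarMLP f) (r : ℝ) : IsScalarMLP fun x => r * f x :=
  IsMLP.map hf (LinearMap.lsmul ℝ (Vec 1) r)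

theorem sub (hf : IsScalarMLP f) (hg : IsScalarMLP g) : IsScalarMLP fun x => f x - g x := by
  simpa only [neg_one_mul, ← sub_eq_add_neg] using hf.add (hg.const_mul (-1))

theorem max_zero (hf : IsScalarMLP f) : IsScalarMLP fun x => max (f x) 0 :=
  IsMLP.relu hf

theorem abs (hf : IsScalarMLP f) : IsScalarMLP fun x => |f x| := by
  simpa [max_zero_add_max_neg_zero_eq_abs_self] using
    hf.max_zero.add (hf.const_mul (-1)).max_zero

theorem sum {ι : Type*} (s : Finset ι) {f : ι → Vec a → ℝ} (hf : ∀ i ∈ s, IsScalarMLP (f i)) :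
    IsScalarMLP fun x => ∑ i ∈ s, f i x := by
  classical
  induction s using Finset.induction_on with
  | empty => simpa only [Finset.sum_empty] using const 0
  | insert i s hi ih =>
    simp only [Finset.sum_insert hi]
    exact (hf i (s.mem_insert_self i)).add (ih fun j hj => hf j (Finset.mem_insert_of_mem hj))

end IsScalarMLP

theorem exists_isScalarMLP_eq_single (S : Finset (Vec a)) (s : Vec a) :
    ∃ f : Vec a → ℝ, IsScalarMLP f ∧ ∀ x ∈ S, f x = if x = s then 1 else 0 := by
  -- A tent around `s` that is steep enough to vanish on the rest of `S`.
  let dist₁ (x : Vec a) : ℝ := ∑ i, |x i - s i|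
  have dist₁_pos {x : Vec a} (hx : x ≠ s) : 0 < dist₁ x := by
    obtain ⟨i, hi⟩ := Function.ne_iff.1 hx
    exact Finset.sum_pos' (fun _ _ => abs_nonneg _) ⟨i, Finset.mem_univ i, abs_sub_pos.2 hi⟩
  obtain ⟨C, hC⟩ : ∃ C : ℝ, ∀ x ∈ S, x ≠ s → 1 ≤ C * dist₁ x := by
    refine Filter.Eventually.exists (f := Filter.atTop) ((Filter.eventually_all_finset S).2
      fun x _ => ?_)
    by_cases hx : x = s
    · simp [hx]
    · simpa [hx] using (Filter.tendsto_id.atTop_mul_const (dist₁_pos hx)).eventually_ge_atTop 1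
  refine ⟨fun x => max (1 - C * dist₁ x) 0, ?_, fun x hx => ?_⟩
  · exact ((IsScalarMLP.const 1).sub ((IsScalarMLP.sum _ fun i _ =>
      ((IsScalarMLP.eval i).sub (.const _)).abs).const_mul C)).max_zero
  · split_ifs with hxs
    · simp [hxs, dist₁]
    · exact max_eq_right (sub_nonpos.2 (hC x hx hxs))

theorem exists_isMLP_eqOn (S : Finset (Vec a)) (g : Vec a → Vec b) :
    ∃ f : Vec a → Vec b, IsMLP f ∧ ∀ x ∈ S, f x = g x := by
  choose ind h_ind ind_eq using exists_isScalarMLP_eq_single S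
  refine ⟨fun x i => ∑ s ∈ S, g s i * ind s x,
    .pi fun i => .sum S fun s _ => (h_ind s).const_mul (g s i), fun x hx => ?_⟩
  ext i
  simp [ind_eq _ x hx, hx]

theorem multiset_sum_apply (s : Multiset (Vec a)) (i : Fin a) :
    s.sum i = (s.map fun x => x i).sum :=
  map_multiset_sum (Pi.evalAddMonoidHom (fun _ : Fin a => ℝ) i) s

/-- With one-hot encodings of the elements of `S`, the sum lists the multiplicities. -/
theorem exists_isMLP_injOn_sum_map (S : Finset (Vec a)) :
    ∃ (N : ℕ) (phi : Vec a → Vec N), IsMLP phi ∧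
      Set.InjOn (fun s : Multiset (Vec a) => (s.map phi).sum) {s | ∀ x ∈ s, x ∈ S} := by
  choose ind h_ind ind_eq using exists_isScalarMLP_eq_single S
  let phi (x : Vec a) : Vec S.card := fun i => ind (S.equivFin.symm i) x
  have sum_phi {s : Multiset (Vec a)} (hs : ∀ x ∈ s, x ∈ S) (y : S) :
      (s.map phi).sum (S.equivFin y) = s.count (y : Vec a) := by
    calc (s.map phi).sum (S.equivFin y) = (s.map fun x => if x = y.1 then (1 : ℝ) else 0).sum := by
          rw [multiset_sum_apply, Multiset.map_map]
          refine congrArg _ (Multiset.map_congr rfl fun x hx => ?_)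
          simp [phi, ind_eq _ x (hs x hx)]
      _ = s.count (y : Vec a) := by
          rw [Finset.sum_multiset_map_count]
          simp [eq_comm (a := (0 : ℝ))]
  refine ⟨S.card, phi, .pi fun i => h_ind _, fun s hs t ht hst => Multiset.ext.2 fun y => ?_⟩
  by_cases hy : y ∈ S
  · have := congrFun hst (S.equivFin ⟨y, hy⟩)
    simpa only [sum_phi hs, sum_phi ht, Nat.cast_inj] using this
  · rw [Multiset.count_eq_zero_of_notMem (mt (hs y) hy),
      Multiset.count_eq_zero_of_notMem (mt (ht y) hy)]

end MLP

/-! ### Message passing and colour refinement -/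

section WL1

variable {F d : ℕ} {V V' : Type} [Fintype V] [Fintype V'] {loops : Bool}
  {G : SimpleGraph V} {G' : SimpleGraph V'} {X : V → Vec F} {X' : V' → Vec F}

theorem mem_nbhd {v w : V} : w ∈ nbhd loops G v ↔ G.Adj v w ∨ (loops = true ∧ w = v) := by
  simp [nbhd]

open Classical in
theorem map_nbhd_val {α : Type*} (loops : Bool) (G : SimpleGraph V) (f : V → α) (v : V) :
    (nbhd loops G v).val.map f =
      (if loops = true then {f v} else 0) + (Finset.univ.filter fun w => G.Adj v w).val.map f := by
  cases loops with
  | false => simp [nbhd]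
  | true =>
    have h : nbhd true G v = insert v (Finset.univ.filter fun w => G.Adj v w) := by
      ext w
      simp [mem_nbhd, or_comm]
    simp [h]

theorem MPStack.exists_eval_eq_comp_wl1 (loops : Bool) (s : MPStack F d) :
    ∃ (t : ℕ) (g : WL1Color F t → Vec d), ∀ {V : Type} [Fintype V] (G : SimpleGraph V)
      (X : V → Vec F) (v : V), s.eval loops G X v = g (wl1 G X t v) := by
  induction s with
  | input => exact ⟨0, id, fun _ _ _ => rfl⟩
  | layer prev l ih =>
    obtain ⟨t, g, hg⟩ := ih
    refine ⟨t + 1, fun c => l.upd (Fin.append (g c.1)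
      (l.agg (((if loops = true then {c.1} else 0) + c.2).map fun c' =>
        l.phi (Fin.append (g c.1) (g c'))))), fun G X v => ?_⟩
    simp only [eval, hg, wl1, ← map_nbhd_val, Multiset.map_map, Function.comp_def]

theorem MPNN.score_eq_of_not_wl1Separates {e : V × V} {e' : V' × V'}
    (h : ¬ WL1Separates G X e G' X' e') (M : MPNN F) (loops : Bool) :
    M.score loops G X e.1 e.2 = M.score loops G' X' e'.1 e'.2 := by
  obtain ⟨t, g, hg⟩ := M.layers.exists_eval_eq_comp_wl1 loops
  simp only [WL1Separates, not_exists, not_not, Prod.mk.injEq] at h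
  rw [score, score, hg, hg, hg, hg, (h t).1, (h t).2]

/-- The layer that concatenates the state of a node with the sum of `phi` over its neighbours. -/
def sumLayer {N : ℕ} (phi : Vec d → Vec N) : MPLayer d (d + N) where
  m := N
  phi := fun z => phi (rightBlock d d z)
  agg := fun s => s.sum
  upd := fun z => z

theorem isNeural_sumLayer {N : ℕ} {phi : Vec d → Vec N} (h : IsMLP phi) :
    (sumLayer phi).IsNeural :=
  ⟨h.comp (IsMLP.id.map (rightBlock d d)), .sum, .id⟩

open Classical in
theorem eval_layer_sumLayer {N : ℕ} (phi : Vec d → Vec N) (s : MPStack F d) (v : V) :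
    (MPStack.layer s (sumLayer phi)).eval loops G X v =
      Fin.append (s.eval loops G X v) ((((if loops = true then {s.eval loops G X v} else 0) +
        (Finset.univ.filter fun w => G.Adj v w).val.map (s.eval loops G X)).map phi).sum) := by
  rw [← map_nbhd_val, Multiset.map_map]
  simp [MPStack.eval, sumLayer]

open Classical in
theorem exists_decode_sumLayer (loops : Bool) (S : Finset (Vec d)) :
    ∃ (N : ℕ) (phi : Vec d → Vec N) (decode : Vec (d + N) → Vec d × Multiset (Vec d)), IsMLP phi ∧
      ∀ {V : Type} [Fintype V] (G : SimpleGraph V) (X : V → Vec F) (s : MPStack F d),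
        (∀ v, s.eval loops G X v ∈ S) → ∀ v,
          decode ((MPStack.layer s (sumLayer phi)).eval loops G X v) =
            (s.eval loops G X v,
              (Finset.univ.filter fun w => G.Adj v w).val.map (s.eval loops G X)) := by
  obtain ⟨N, phi, h_phi, phi_inj⟩ := exists_isMLP_injOn_sum_map S
  refine ⟨N, phi, fun z => (leftBlock d N z,
    Function.invFunOn (fun s : Multiset (Vec d) => (s.map phi).sum) {s | ∀ x ∈ s, x ∈ S}
      (rightBlock d N z) - if loops = true then {leftBlock d N z} else 0), h_phi,
    fun G X s hS v => ?_⟩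
  simp only [eval_layer_sumLayer, leftBlock_append, rightBlock_append]
  refine congrArg _ (tsub_eq_of_eq_add_rev (phi_inj.leftInvOn_invFunOn ?_))
  rw [← map_nbhd_val]
  simp [hS]

theorem exists_mpStack_decode_eq_wl1 (loops : Bool) (G : SimpleGraph V) (G' : SimpleGraph V')
    (X : V → Vec F) (X' : V' → Vec F) (t : ℕ) :
    ∃ (d : ℕ) (s : MPStack F d) (decode : Vec d → WL1Color F t), s.IsNeural ∧
      (∀ v, decode (s.eval loops G X v) = wl1 G X t v) ∧
      ∀ v, decode (s.eval loops G' X' v) = wl1 G' X' t v := by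
  classical
  induction t with
  | zero => exact ⟨F, .input, id, trivial, fun _ => rfl, fun _ => rfl⟩
  | succ t ih =>
    obtain ⟨d, s, decode, hs, h, h'⟩ := ih
    obtain ⟨N, phi, decodeLayer, h_phi, h_layer⟩ := exists_decode_sumLayer (F := F) loops
      (Finset.univ.image (s.eval loops G X) ∪ Finset.univ.image (s.eval loops G' X'))
    refine ⟨d + N, .layer s (sumLayer phi), fun z => (decode (decodeLayer z).1,
      (decodeLayer z).2.map decode), ⟨hs, isNeural_sumLayer h_phi⟩, fun v => ?_, fun v => ?_⟩
    · simp only [h_layer G X s (by simp), wl1, h, Multiset.map_map, Function.comp_def]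
      rfl
    · simp only [h_layer G' X' s (by simp), wl1, h', Multiset.map_map, Function.comp_def]
      rfl

theorem WL1Separates.exists_mpnn_score_ne {e : V × V} {e' : V' × V'}
    (h : WL1Separates G X e G' X' e') (loops : Bool) :
    ∃ M : MPNN F, M.IsNeural ∧
      M.score loops G X e.1 e.2 ≠ M.score loops G' X' e'.1 e'.2 := by
  obtain ⟨t, ht⟩ := h
  obtain ⟨d, s, decode, hs, h, h'⟩ := exists_mpStack_decode_eq_wl1 loops G G' X X' t
  have h_append : Fin.append (s.eval loops G X e.1) (s.eval loops G X e.2) ≠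
      Fin.append (s.eval loops G' X' e'.1) (s.eval loops G' X' e'.2) := by
    intro heq
    have heq₁ := congrArg (leftBlock d d) heq
    have heq₂ := congrArg (rightBlock d d) heq
    simp only [leftBlock_append, rightBlock_append] at heq₁ heq₂
    exact ht (by rw [← h, ← h, ← h', ← h', heq₁, heq₂])
  obtain ⟨i, hi⟩ := Function.ne_iff.1 h_append
  exact ⟨⟨d, s, d + d, Fin.append, fun y _ => y i⟩, ⟨hs, .concat, IsScalarMLP.eval i⟩,
    Real.sigmoid_injective.ne hi⟩

end WL1

/-! ### Standard MPNNs as MPNNs with Bloom signatures -/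

section ToBloom

variable {F d d' n : ℕ} {V V' : Type} [Fintype V] [Fintype V']

/-- A message passing layer as one that ignores the edge features. -/
def MPLayer.toBloom (e : ℕ) (l : MPLayer d d') : BloomLayer e d d' where
  m := l.m
  phi z := l.phi (appendLinearMap (rightBlock d d) (leftBlock d d) (leftBlock (d + d) e z))
  agg := l.agg
  upd := l.upd

theorem MPLayer.IsNeural.toBloom {l : MPLayer d d'} (hl : l.IsNeural) (e : ℕ) :
    (l.toBloom e).IsNeural :=
  ⟨hl.1.comp ((IsMLP.id.map _).map _), hl.2⟩

/-- Message passing layers as ones that ignore the edge features. -/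
def MPStack.toBloom (e : ℕ) : {d : ℕ} → MPStack F d → BloomStack e F d
  | _, .input => .input
  | _, .layer prev l => .layer (prev.toBloom e) (l.toBloom e)

theorem MPStack.IsNeural.toBloom {s : MPStack F d} (hs : s.IsNeural) (e : ℕ) :
    (s.toBloom e).IsNeural := by
  induction s with
  | input => trivial
  | layer prev l ih => exact ⟨ih hs.1, hs.2.toBloom e⟩

theorem MPStack.eval_toBloom {e : ℕ} (s : MPStack F d) (loops : Bool) (G : SimpleGraph V)
    (E : V → V → Vec e) (X : V → Vec F) (v : V) :
    (s.toBloom e).eval loops G E X v = s.eval loops G X v := by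
  induction s generalizing v with
  | input => rfl
  | layer prev l ih =>
    simp only [toBloom, BloomStack.eval, eval, MPLayer.toBloom, ih, appendLinearMap_apply,
      leftBlock_append, rightBlock_append]

/-- A standard MPNN as an MPNN with Bloom signatures that ignores the signatures: the edge features
and the pairwise structural features have dimension `0`. -/
def MPNN.toBloom (n : ℕ) (M : MPNN F) : BloomNet n F 1 where
  e := 0
  psi _ := 0
  d := M.d
  layers := M.layers.toBloom 0
  k := M.k
  dec := M.dec
  p := 0
  sHat _ := 0
  head z := M.head (leftBlock M.k 0 z)

theorem MPNN.IsNeural.toBloom {M : MPNN F} (hM : M.IsNeural) (n : ℕ) : (M.toBloom n).IsNeural :=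
  ⟨.const 0, hM.1.toBloom 0, hM.2.1, .const 0, hM.2.2.comp (IsMLP.id.map _)⟩

theorem MPNN.score_toBloom (M : MPNN F) (loops : Bool) (G : SimpleGraph V) (X : V → Vec F)
    (H : V → Fin n) (u v : V) :
    (M.toBloom n).score loops G X H u v = M.score loops G X u v := by
  simp only [BloomNet.score, BloomNet.pair, BloomNet.node, score, toBloom, MPStack.eval_toBloom,
    leftBlock_append]

theorem WL1Separates.exists_bloomNet_score_ne {G : SimpleGraph V} {G' : SimpleGraph V'}
    {X : V → Vec F} {X' : V' → Vec F} {e : V × V} {e' : V' × V'}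
    (h : WL1Separates G X e G' X' e') (loops : Bool) (n : ℕ) :
    ∃ B : BloomNet n F 1, B.IsNeural ∧ ∀ (H : V → Fin n) (H' : V' → Fin n),
      B.score loops G X H e.1 e.2 ≠ B.score loops G' X' H' e'.1 e'.2 := by
  obtain ⟨M, hM, hne⟩ := h.exists_mpnn_score_ne loops
  exact ⟨M.toBloom n, hM.toBloom n, fun H H' => by simpa only [MPNN.score_toBloom] using hne⟩

end ToBloom

/-! ### Regular graphs -/

section Regular

variable {F k : ℕ} {V V' : Type} [Fintype V] [Fintype V'] {G : SimpleGraph V}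
  {G' : SimpleGraph V'} [G.LocallyFinite] [G'.LocallyFinite]

open Classical in
theorem card_filter_adj (v : V) : (Finset.univ.filter fun w => G.Adj v w).card = G.degree v := by
  rw [← G.card_neighborFinset_eq_degree]
  congr 1
  ext w
  simp

theorem wl1_const_eq_of_isRegularOfDegree (hG : G.IsRegularOfDegree k)
    (hG' : G'.IsRegularOfDegree k) (x : Vec F) (t : ℕ) (v : V) (v' : V') :
    wl1 G (fun _ => x) t v = wl1 G' (fun _ => x) t v' := by
  classical
  induction t generalizing v v' with
  | zero => rfl
  | succ t ih =>
    refine Prod.ext (ih v v') ?_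
    calc (Finset.univ.filter fun w => G.Adj v w).val.map (wl1 G (fun _ => x) t)
        = .replicate k (wl1 G' (fun _ => x) t v') := by
          rw [Multiset.map_congr rfl fun w _ => ih w v', Multiset.map_const', Finset.card_val,
            card_filter_adj, hG v]
      _ = (Finset.univ.filter fun w => G'.Adj v' w).val.map (wl1 G' (fun _ => x) t) := by
          rw [Multiset.map_congr rfl fun w _ => (ih v w).symm.trans (ih v v'), Multiset.map_const',
            Finset.card_val, card_filter_adj, hG' v']

theorem not_wl1Separates_const_of_isRegularOfDegree (hG : G.IsRegularOfDegree k)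
    (hG' : G'.IsRegularOfDegree k) (x : Vec F) (e : V × V) (e' : V' × V') :
    ¬ WL1Separates G (fun _ => x) e G' (fun _ => x) e' := by
  rintro ⟨t, ht⟩
  exact ht (Prod.ext (wl1_const_eq_of_isRegularOfDegree hG hG' x t _ _)
    (wl1_const_eq_of_isRegularOfDegree hG hG' x t _ _))

end Regular

/-! ### Strongly regular graphs and 3-WL -/

section WL

variable {ι κ : Type*} {V V' : Type} {G : SimpleGraph V} {G' : SimpleGraph V'}

/-- The ordered induced subgraphs on `(w, x)` and `(w', x')` are isomorphic. -/
def SameRel (G : SimpleGraph V) (G' : SimpleGraph V') (w x : V) (w' x' : V') : Prop :=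
  (w = x ↔ w' = x') ∧ (G.Adj w x ↔ G'.Adj w' x')

/-- The ordered induced subgraphs on the tuples `a` and `b` are isomorphic. -/
def SameType (G : SimpleGraph V) (G' : SimpleGraph V') (a : ι → V) (b : ι → V') : Prop :=
  ∀ i j, SameRel G G' (a i) (a j) (b i) (b j)

/-- Tuples of the same isomorphism type have equally many one-point extensions of each type. -/
def ExtensionProperty (ι : Type*) (G : SimpleGraph V) (G' : SimpleGraph V') : Prop :=
  ∀ (a : ι → V) (b : ι → V'), SameType G G' a b →
    ∃ e : V ≃ V', ∀ w j, SameRel G G' w (a j) (e w) (b j)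

theorem SameRel.symm {w x : V} {w' x' : V'} (h : SameRel G G' w x w' x') :
    SameRel G G' x w x' w' := by
  simpa only [SameRel, eq_comm, SimpleGraph.adj_comm] using h

theorem SameType.insertNth {m : ℕ} {a : Fin m → V} {b : Fin m → V'} (hab : SameType G G' a b)
    (i : Fin (m + 1)) {w : V} {w' : V'} (hw : ∀ j, SameRel G G' w (a j) w' (b j)) :
    SameType G G' (i.insertNth w a) (i.insertNth w' b) := by
  simp only [SameType, i.forall_iff_succAbove, Fin.insertNth_apply_same,
    Fin.insertNth_apply_succAbove]
  exact ⟨⟨by simp [SameRel], hw⟩, fun j => ⟨(hw j).symm, hab j⟩⟩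

theorem ExtensionProperty.of_surjective (h : ExtensionProperty κ G G') {f : κ → ι}
    (hf : f.Surjective) : ExtensionProperty ι G G' := fun a b hab => by
  obtain ⟨e, he⟩ := h (a ∘ f) (b ∘ f) fun i j => hab (f i) (f j)
  exact ⟨e, fun w => hf.forall.2 (he w)⟩

theorem exists_equiv_apply_eq {γ : Type*} [Finite ι] {f : V → γ} {f' : V' → γ} {a : ι → V}
    {b : ι → V'} (hab : ∀ i j, a i = a j ↔ b i = b j) (hf : ∀ i, f (a i) = f' (b i)) {e₀ : V ≃ V'}
    (he₀ : ∀ w, f w = f' (e₀ w)) :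
    ∃ e : V ≃ V', (∀ w, f w = f' (e w)) ∧ ∀ i, e (a i) = b i := by
  classical
  have := Fintype.ofFinite ι
  suffices h : ∀ s : Finset ι, ∃ e : V ≃ V', (∀ w, f w = f' (e w)) ∧ ∀ i ∈ s, e (a i) = b i by
    simpa using h Finset.univ
  intro s
  induction s using Finset.induction_on with
  | empty => exact ⟨e₀, he₀, by simp⟩
  | insert i s _ ih =>
    obtain ⟨e, he, hes⟩ := ih
    refine ⟨e.trans (.swap (e (a i)) (b i)), fun w => ?_, fun j hj => ?_⟩
    · rw [he, Equiv.trans_apply, Equiv.apply_swap_eq_self ((he _).symm.trans (hf i))]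
    · rw [Equiv.trans_apply]
      by_cases hij : a j = a i
      · rw [hij, Equiv.swap_apply_left, (hab j i).1 hij]
      · have hji : j ∈ s := (Finset.mem_insert.1 hj).resolve_left fun h => hij (h ▸ rfl)
        rw [Equiv.swap_apply_of_ne_of_ne (e.injective.ne hij), hes j hji]
        exact hes j hji ▸ fun h => hij ((hab j i).2 h)

theorem ExtensionProperty.exists_equiv_sameType {m : ℕ}
    (h : ∀ j < m, ExtensionProperty (Fin j) G G') :
    ∃ E : (Fin m → V) ≃ (Fin m → V'), ∀ a, SameType G G' a (E a) := by
  induction m with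
  | zero => exact ⟨.ofUnique _ _, fun a i => i.elim0⟩
  | succ m ih =>
    obtain ⟨E, hE⟩ := ih fun j hj => h j (hj.trans m.lt_succ_self)
    choose e he using fun a => h m m.lt_succ_self a (E a) (hE a)
    refine ⟨(Fin.insertNthEquiv (fun _ => V) 0).symm.trans (((Equiv.prodComm _ _).trans
      ((E.prodShear e).trans (Equiv.prodComm _ _))).trans (Fin.insertNthEquiv (fun _ => V') 0)),
      fun a => ?_⟩
    rw [← Fin.insertNth_self_removeNth 0 a]
    exact (hE _).insertNth 0 (he _ _)

variable [Fintype V] [Fintype V']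

theorem map_univ_val_congr {α : Type*} (e : V ≃ V') {f : V → α} {f' : V' → α}
    (h : ∀ v, f v = f' (e v)) : Finset.univ.val.map f = Finset.univ.val.map f' := by
  rw [← Multiset.map_univ_val_equiv e, Multiset.map_map]
  exact Multiset.map_congr rfl fun v _ => h v

theorem ExtensionProperty.wl_eq {m : ℕ} (h : ExtensionProperty (Fin m) G G') (t : ℕ)
    {a : Fin (m + 1) → V} {b : Fin (m + 1) → V'} (hab : SameType G G' a b) :
    wl (m + 1) G t a = wl (m + 1) G' t b := by
  induction t generalizing a b with
  | zero => exact funext₂ fun i j => Prod.ext (propext (hab i j).1) (propext (hab i j).2)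
  | succ t ih =>
    refine Prod.ext (ih hab) (funext fun i => ?_)
    have hab_i : SameType G G' (i.removeNth a) (i.removeNth b) := fun j l => hab _ _
    obtain ⟨e, he⟩ := h _ _ hab_i
    refine map_univ_val_congr e fun w => ih ?_
    rw [← Fin.insertNth_removeNth, ← Fin.insertNth_removeNth]
    exact hab_i.insertNth i (he w)

theorem ExtensionProperty.wlEquiv {m : ℕ} (h : ExtensionProperty (Fin m) G G')
    (hcard : Fintype.card V = Fintype.card V') : WLEquiv (m + 1) G G' := by
  have h_le : ∀ j < m + 1, ExtensionProperty (Fin j) G G' := fun j hj => by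
    rcases j.eq_zero_or_pos with rfl | hj₀
    · exact fun _ _ _ => ⟨Fintype.equivOfCardEq hcard, fun _ i => i.elim0⟩
    · have : Nonempty (Fin j) := ⟨⟨0, hj₀⟩⟩
      exact h.of_surjective (Function.invFun_surjective
        (Fin.castLE_injective (Nat.lt_succ_iff.1 hj)))
  obtain ⟨E, hE⟩ := ExtensionProperty.exists_equiv_sameType h_le
  exact fun t => map_univ_val_congr E fun a => h.wl_eq t (hE a)

theorem exists_equiv_of_card_fibre_eq {γ : Type*} [DecidableEq γ] {f : V → γ} {f' : V' → γ}
    (h : ∀ c, Fintype.card {w // f w = c} = Fintype.card {w // f' w = c}) :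
    ∃ e : V ≃ V', ∀ w, f w = f' (e w) :=
  ⟨.ofFiberEquiv fun c => Fintype.equivOfCardEq (h c), fun w =>
    (Equiv.ofFiberEquiv_map (fun c => Fintype.equivOfCardEq (h c)) w).symm⟩

theorem exists_equiv_mem_iff [DecidableEq V] [DecidableEq V'] {s t : Finset V} {s' t' : Finset V'}
    (hcard : Fintype.card V = Fintype.card V') (hs : s.card = s'.card) (ht : t.card = t'.card)
    (hst : (s ∩ t).card = (s' ∩ t').card) :
    ∃ e : V ≃ V', ∀ w, (w ∈ s ↔ e w ∈ s') ∧ (w ∈ t ↔ e w ∈ t') := by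
  obtain ⟨e, he⟩ := exists_equiv_of_card_fibre_eq (f := fun w => (decide (w ∈ s), decide (w ∈ t)))
    (f' := fun w => (decide (w ∈ s'), decide (w ∈ t'))) fun (p, q) => by
    have h₁ := Finset.card_inter_add_card_sdiff s t
    have h₁' := Finset.card_inter_add_card_sdiff s' t'
    have h₂ := Finset.card_inter_add_card_sdiff t s
    have h₂' := Finset.card_inter_add_card_sdiff t' s'
    have h₃ := Finset.card_union_add_card_inter s t
    have h₃' := Finset.card_union_add_card_inter s' t'
    have h₄ := Finset.card_compl_add_card (s ∪ t)
    have h₄' := Finset.card_compl_add_card (s' ∪ t')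
    rw [Finset.inter_comm] at h₂ h₂'
    rw [Finset.compl_union] at h₄ h₄'
    cases p <;> cases q <;>
      simp only [Fintype.card_subtype, Prod.mk.injEq, decide_eq_true_eq, decide_eq_false_iff_not,
        Finset.filter_and, Finset.filter_not, Finset.filter_mem_eq_inter, Finset.univ_inter,
        ← Finset.compl_eq_univ_sdiff, ← Finset.sdiff_eq_inter_compl,
        Finset.inter_comm sᶜ t, Finset.inter_comm s'ᶜ t'] at h₄ h₄' ⊢ <;>
      omega
  exact ⟨e, fun w => by simpa using he w⟩

variable [DecidableRel G.Adj] [DecidableRel G'.Adj]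

theorem card_neighborFinset_inter_of_isSRGWith [DecidableEq V] {n k ℓ μ : ℕ}
    (hG : G.IsSRGWith n k ℓ μ) (x y : V) :
    (G.neighborFinset x ∩ G.neighborFinset y).card =
      if x = y then k else if G.Adj x y then ℓ else μ := by
  have h_common : (G.neighborFinset x ∩ G.neighborFinset y).card =
      Fintype.card (G.commonNeighbors x y) := by
    rw [← Set.toFinset_card]
    congr 1
    ext
    simp [SimpleGraph.mem_commonNeighbors]
  split_ifs with hxy hadj
  · rw [hxy, Finset.inter_self, G.card_neighborFinset_eq_degree, hG.regular y]
  · rw [h_common, hG.of_adj x y hadj]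
  · rw [h_common, hG.of_not_adj hxy hadj]

theorem extensionProperty_fin_two_of_isSRGWith {n k ℓ μ : ℕ} (hG : G.IsSRGWith n k ℓ μ)
    (hG' : G'.IsSRGWith n k ℓ μ) : ExtensionProperty (Fin 2) G G' := by
  classical
  intro a b hab
  obtain ⟨e₀, he₀⟩ : ∃ e : V ≃ V', ∀ w,
      (w ∈ G.neighborFinset (a 0) ↔ e w ∈ G'.neighborFinset (b 0)) ∧
      (w ∈ G.neighborFinset (a 1) ↔ e w ∈ G'.neighborFinset (b 1)) := by
    refine exists_equiv_mem_iff (hG.card.trans hG'.card.symm) ?_ ?_ ?_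
    · simp only [SimpleGraph.card_neighborFinset_eq_degree, hG.regular.degree_eq,
        hG'.regular.degree_eq]
    · simp only [SimpleGraph.card_neighborFinset_eq_degree, hG.regular.degree_eq,
        hG'.regular.degree_eq]
    · simp only [card_neighborFinset_inter_of_isSRGWith hG,
        card_neighborFinset_inter_of_isSRGWith hG', (hab 0 1).1, (hab 0 1).2]
  obtain ⟨e, he, hea⟩ := exists_equiv_apply_eq (fun i j => (hab i j).1)
    (f := fun w j => G.Adj w (a j)) (f' := fun w j => G'.Adj w (b j))
    (fun i => funext fun j => propext (hab i j).2) (e₀ := e₀) fun w => by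
      simpa [funext_iff, Fin.forall_fin_two, SimpleGraph.adj_comm] using he₀ w
  refine ⟨e, fun w j => ⟨?_, (congrFun (he w) j).to_iff⟩⟩
  rw [← hea j, e.apply_eq_iff_eq]

theorem wlEquiv_three_of_isSRGWith {n k ℓ μ : ℕ} (hG : G.IsSRGWith n k ℓ μ)
    (hG' : G'.IsSRGWith n k ℓ μ) : WLEquiv 3 G G' :=
  (extensionProperty_fin_two_of_isSRGWith hG hG').wlEquiv (hG.card.trans hG'.card.symm)

end WL

/-! ### Networks that decode the hash function -/

section HashNet

variable {F n r : ℕ} {V V' : Type} [Fintype V] [Fintype V'] {loops : Bool} {G : SimpleGraph V}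
  {G' : SimpleGraph V'} {H : V → Fin n} {H' : V' → Fin n}

/-- Distinct nodes have incomparable neighbourhoods, so that `u` is the only node whose
neighbourhood contains that of `u`. -/
def NbhdAntichain (loops : Bool) (G : SimpleGraph V) : Prop :=
  ∀ ⦃u x⦄, nbhd loops G u ⊆ nbhd loops G x → u = x

theorem mem_nbhd_comm {v w : V} : w ∈ nbhd loops G v ↔ v ∈ nbhd loops G w := by
  rw [mem_nbhd, mem_nbhd, G.adj_comm, @eq_comm V v]

theorem NbhdAntichain.nbhd_nonempty [Nontrivial V] (hG : NbhdAntichain loops G) (u : V) :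
    (nbhd loops G u).Nonempty := by
  obtain ⟨x, hx⟩ := exists_ne u
  by_contra h_empty
  rw [Finset.not_nonempty_iff_eq_empty] at h_empty
  exact hx (hG (h_empty ▸ Finset.empty_subset _)).symm

theorem bloomSig_apply_hash [DecidableEq V] (hH : H.Injective) (v w : V) :
    bloomSig loops G H v (H w) = if w ∈ nbhd loops G v then 1 else 0 := by
  simp [bloomSig, hH.eq_iff]

theorem NbhdAntichain.forall_mem_bloomSig_eq_one_iff [Nontrivial V] (hG : NbhdAntichain loops G)
    (hH : H.Injective) (u : V) (j : Fin n) :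
    (∀ w ∈ nbhd loops G u, bloomSig loops G H w j = 1) ↔ j = H u := by
  classical
  constructor
  · intro h
    have h_mem : ∀ w ∈ nbhd loops G u, ∃ x ∈ nbhd loops G w, H x = j := fun w hw => by
      simpa [bloomSig] using h w hw
    obtain ⟨w, hw⟩ := hG.nbhd_nonempty u
    obtain ⟨x, -, rfl⟩ := h_mem w hw
    refine congrArg H (hG fun w hw => mem_nbhd_comm.1 ?_).symm
    obtain ⟨y, hy, hyx⟩ := h_mem w hw
    exact hH hyx ▸ hy
  · rintro rfl w hw
    rw [bloomSig_apply_hash hH, if_pos (mem_nbhd_comm.1 hw)]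

theorem max_sum_sub_one_add_one {ι : Type*} (s : Finset ι) (p : ι → Prop) [DecidablePred p] :
    max (∑ i ∈ s, ((if p i then (1 : ℝ) else 0) - 1) + 1) 0 = if ∀ i ∈ s, p i then 1 else 0 := by
  have h_sum : ∑ i ∈ s, ((if p i then (1 : ℝ) else 0) - 1) = -(s.filter fun i => ¬p i).card := by
    rw [Finset.natCast_card_filter, ← Finset.sum_neg_distrib]
    exact Finset.sum_congr rfl fun i _ => by split_ifs <;> norm_num
  rw [h_sum]
  split_ifs with h
  · rw [Finset.filter_false_of_mem fun i hi => not_not.2 (h i hi)]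
    norm_num
  · have h_pos : 1 ≤ (s.filter fun i => ¬p i).card := by
      push Not at h
      simpa only [Nat.one_le_iff_ne_zero, Finset.card_ne_zero] using Finset.filter_nonempty_iff.2 h
    rw [max_eq_right]
    linarith [(Nat.one_le_cast (α := ℝ)).2 h_pos]

/-- The network with edge features `e_{w,v} = s_w - 1`, node representations
`ReLU (1 + ∑ w ∈ N(v), e_{w,v})` and pair representations `head (h_u || h_v || s_u || s_v)`.
A node representation is the conjunction of the signatures of the neighbours. -/
def hashNet (n F : ℕ) (head : Vec (n + n + (n + n)) → Vec r) : BloomNet n F r where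
  e := n
  psi z j := z (Fin.castAdd n j) - 1
  d := n
  layers := .layer .input
    { m := n
      phi := rightBlock (F + F) n
      agg := fun s => s.sum
      upd := fun x j => max (x (Fin.natAdd F j) + 1) 0 }
  k := n + n
  dec := fun x y => Fin.append x y
  p := n + n
  sHat := fun z => z
  head := head

theorem isNeural_hashNet (F : ℕ) {head : Vec (n + n + (n + n)) → Vec r} (h : IsMLP head) :
    (hashNet n F head).IsNeural :=
  ⟨.pi fun _ => (IsScalarMLP.eval _).sub (.const 1),
    ⟨trivial, IsMLP.id.map _, .sum, .pi fun _ => ((IsScalarMLP.eval _).add (.const 1)).max_zero⟩,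
    .concat, .id, h⟩

theorem NbhdAntichain.node_hashNet [Nontrivial V] (hG : NbhdAntichain loops G) (hH : H.Injective)
    (head : Vec (n + n + (n + n)) → Vec r) (X : V → Vec F) (u : V) :
    (hashNet n F head).node loops G X H u = Pi.single (H u) 1 := by
  classical
  funext (j : Fin n)
  have h_node : (hashNet n F head).node loops G X H u j =
      max (∑ w ∈ nbhd loops G u, (bloomSig loops G H w j - 1) + 1) 0 := by
    simp only [BloomNet.node, hashNet, BloomStack.eval, Fin.append_left, Fin.append_right,
      rightBlock_append, multiset_sum_apply, Multiset.map_map, Function.comp_apply]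
    rfl
  have h_bool : ∀ w, bloomSig loops G H w j = if bloomSig loops G H w j = 1 then 1 else 0 :=
    fun w => by simp [bloomSig]
  rw [h_node, Finset.sum_congr rfl fun w _ => congrArg (· - 1) (h_bool w), max_sum_sub_one_add_one]
  simp only [hG.forall_mem_bloomSig_eq_one_iff hH]
  exact (Pi.single_apply (H u) (1 : ℝ) j).symm

theorem NbhdAntichain.pair_hashNet [Nontrivial V] (hG : NbhdAntichain loops G) (hH : H.Injective)
    (head : Vec (n + n + (n + n)) → Vec r) (X : V → Vec F) (u v : V) :
    (hashNet n F head).pair loops G X H u v =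
      head (Fin.append (Fin.append (Pi.single (H u) 1) (Pi.single (H v) 1))
        (Fin.append (bloomSig loops G H u) (bloomSig loops G H v))) := by
  rw [← hG.node_hashNet hH head X u, ← hG.node_hashNet hH head X v]
  rfl

theorem max_single_add_bloomSig_sub_one (i k j : Fin n) (v : V) :
    max ((Pi.single i 1 : Vec n) k + bloomSig loops G H v j - 1) 0 =
      if k = i then bloomSig loops G H v j else 0 := by
  rw [Pi.single_apply, bloomSig]
  split_ifs <;> norm_num

/-- The head that maps `h_u || h_v || s_u || s_v` to `∑ j, ReLU (h_u[j] + s_v[j] - 1)`, which for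
binary vectors is their inner product. -/
def linkHead (n : ℕ) (y : Vec (n + n + (n + n))) : Vec 1 := fun _ =>
  ∑ j : Fin n, max (y (Fin.castAdd (n + n) (Fin.castAdd n j)) +
    y (Fin.natAdd (n + n) (Fin.natAdd n j)) - 1) 0

theorem isMLP_linkHead (n : ℕ) : IsMLP (linkHead n) :=
  .pi fun _ => .sum _ fun _ _ => (((IsScalarMLP.eval _).add (.eval _)).sub (.const 1)).max_zero

theorem NbhdAntichain.pair_hashNet_linkHead [DecidableEq V] [Nontrivial V]
    (hG : NbhdAntichain loops G) (hH : H.Injective) (X : V → Vec F) (u v : V) :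
    (hashNet n F (linkHead n)).pair loops G X H u v 0 = if u ∈ nbhd loops G v then 1 else 0 := by
  rw [hG.pair_hashNet hH, ← bloomSig_apply_hash hH]
  simp only [linkHead, Fin.append_left, Fin.append_right, max_single_add_bloomSig_sub_one,
    Finset.sum_ite_eq', Finset.mem_univ, if_true]

theorem exists_bloomNet_score_ne_of_mem_nbhd (loops : Bool) (n F : ℕ) :
    ∃ B : BloomNet n F 1, B.IsNeural ∧ ∀ (V V' : Type) [Fintype V] [Fintype V'] [Nontrivial V]
      [Nontrivial V'] (G : SimpleGraph V) (G' : SimpleGraph V'),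
      NbhdAntichain loops G → NbhdAntichain loops G' →
      ∀ (X : V → Vec F) (X' : V' → Vec F) (H : V → Fin n) (H' : V' → Fin n),
      H.Injective → H'.Injective → ∀ {u v u' v'}, u ∈ nbhd loops G v → u' ∉ nbhd loops G' v' →
      B.score loops G X H u v ≠ B.score loops G' X' H' u' v' := by
  classical
  refine ⟨hashNet n F (linkHead n), isNeural_hashNet F (isMLP_linkHead n), ?_⟩
  intro V V' _ _ _ _ G G' hG hG' X X' H H' hH hH' u v u' v' huv huv' h_eq
  have h_pair := Real.sigmoid_injective h_eq
  rw [hG.pair_hashNet_linkHead hH, hG'.pair_hashNet_linkHead hH', if_pos huv, if_neg huv'] at h_pair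
  exact one_ne_zero h_pair

/-- The head whose entry `(i, j)` maps `h_u || h_v || s_u || s_v` to `ReLU (h_u[i] + s_u[j] - 1)`,
which for binary vectors is the product `h_u[i] * s_u[j]`. -/
def edgeHead (n : ℕ) (y : Vec (n + n + (n + n))) : Vec (n * n) := fun k =>
  max (y (Fin.castAdd (n + n) (Fin.castAdd n k.divNat)) +
    y (Fin.natAdd (n + n) (Fin.castAdd n k.modNat)) - 1) 0

theorem isMLP_edgeHead (n : ℕ) : IsMLP (edgeHead n) :=
  .pi fun _ => (((IsScalarMLP.eval _).add (.eval _)).sub (.const 1)).max_zero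

/-- The sum over all node pairs of their representations by `hashNet n F (edgeHead n)`. Its nonzero
entries `(i, j)` are the pairs of hash values of neighbouring nodes. -/
def edgeCode (loops : Bool) (G : SimpleGraph V) (H : V → Fin n) : Vec (n * n) := fun k =>
  ∑ q : V × V, if k.divNat = H q.1 then bloomSig loops G H q.1 k.modNat else 0

theorem NbhdAntichain.sum_pair_hashNet_edgeHead [Nontrivial V] (hG : NbhdAntichain loops G)
    (hH : H.Injective) (X : V → Vec F) :
    ((Finset.univ : Finset (V × V)).val.map fun q =>
      (hashNet n F (edgeHead n)).pair loops G X H q.1 q.2).sum = edgeCode loops G H := by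
  funext k
  rw [multiset_sum_apply, Multiset.map_map]
  simp only [Function.comp_apply, hG.pair_hashNet hH, edgeHead, edgeCode, Fin.append_left,
    Fin.append_right, max_single_add_bloomSig_sub_one]
  rfl

theorem edgeCode_ne_zero_iff (loops : Bool) (G : SimpleGraph V) (H : V → Fin n) (i j : Fin n) :
    edgeCode loops G H (finProdFinEquiv (i, j)) ≠ 0 ↔
      Relation.Map (fun u w => w ∈ nbhd loops G u) H H i j := by
  have h_nonneg : ∀ q ∈ (Finset.univ : Finset (V × V)),
      0 ≤ if i = H q.1 then bloomSig loops G H q.1 j else 0 := fun q _ => by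
    rw [bloomSig]
    split_ifs <;> norm_num
  obtain ⟨hi, hj⟩ := Prod.mk.inj (finProdFinEquiv.symm_apply_apply (i, j))
  rw [edgeCode, hi, hj, Ne, Finset.sum_eq_zero_iff_of_nonneg h_nonneg]
  constructor
  · intro h
    simp only [Finset.mem_univ, forall_const, not_forall, bloomSig, ite_eq_right_iff, one_ne_zero,
      imp_false, not_not] at h
    obtain ⟨⟨u, _⟩, rfl, w, hw, rfl⟩ := h
    exact ⟨u, w, hw, rfl, rfl⟩
  · rintro ⟨u, w, hw, rfl, rfl⟩ h
    have h_uu := h (u, u) (Finset.mem_univ _)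
    rw [if_pos rfl, bloomSig, if_pos ⟨w, hw, rfl⟩] at h_uu
    exact one_ne_zero h_uu

theorem range_eq_setOf_map_nbhd (hG : ∀ u, (nbhd loops G u).Nonempty) :
    Set.range H = {i | ∃ j, Relation.Map (fun u w => w ∈ nbhd loops G u) H H i j} := by
  ext i
  constructor
  · rintro ⟨u, rfl⟩
    obtain ⟨w, hw⟩ := hG u
    exact ⟨H w, u, w, hw, rfl, rfl⟩
  · rintro ⟨_, u, _, _, rfl, _⟩
    exact ⟨u, rfl⟩

theorem nonempty_iso_of_map_nbhd_eq (hH : H.Injective) (hH' : H'.Injective)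
    (hG : ∀ u, (nbhd loops G u).Nonempty) (hG' : ∀ u, (nbhd loops G' u).Nonempty)
    (h : ∀ i j, Relation.Map (fun u w => w ∈ nbhd loops G u) H H i j ↔
      Relation.Map (fun u w => w ∈ nbhd loops G' u) H' H' i j) :
    Nonempty (G ≃g G') := by
  have h_range : Set.range H = Set.range H' := by
    rw [range_eq_setOf_map_nbhd hG, range_eq_setOf_map_nbhd hG']
    simp only [h]
  let e : V ≃ V' := (Equiv.ofInjective H hH).trans
    ((Equiv.setCongr h_range).trans (Equiv.ofInjective H' hH').symm)
  have he : ∀ u, H' (e u) = H u := fun u => by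
    simp only [e, Equiv.trans_apply, Equiv.apply_ofInjective_symm, Equiv.setCongr_apply,
      Equiv.ofInjective_apply]
  have h_mem : ∀ u w, w ∈ nbhd loops G u ↔ e w ∈ nbhd loops G' (e u) := fun u w => by
    have h_hash := h (H u) (H w)
    rwa [Relation.map_apply_apply hH hH, ← he, ← he, Relation.map_apply_apply hH' hH'] at h_hash
  refine ⟨⟨e, fun {u w} => ?_⟩⟩
  by_cases huw : w = u
  · simp [huw]
  · simpa [mem_nbhd, huw] using (h_mem u w).symm

theorem nonempty_iso_of_edgeCode_eq [Nontrivial V] [Nontrivial V'] (hG : NbhdAntichain loops G)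
    (hG' : NbhdAntichain loops G') (hH : H.Injective) (hH' : H'.Injective)
    (h : edgeCode loops G H = edgeCode loops G' H') : Nonempty (G ≃g G') := by
  refine nonempty_iso_of_map_nbhd_eq hH hH' hG.nbhd_nonempty hG'.nbhd_nonempty fun i j => ?_
  rw [← edgeCode_ne_zero_iff, ← edgeCode_ne_zero_iff, h]

theorem exists_bloomGraphNet_output_ne [Nontrivial V] [Nontrivial V'] (n F : ℕ)
    (hG : NbhdAntichain loops G) (hG' : NbhdAntichain loops G') (h_iso : IsEmpty (G ≃g G')) :
    ∃ B : BloomGraphNet n F, B.IsNeural ∧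
      ∀ (X : V → Vec F) (X' : V' → Vec F) (H : V → Fin n) (H' : V' → Fin n),
        H.Injective → H'.Injective → B.output loops G X H ≠ B.output loops G' X' H' := by
  classical
  have h_code_ne : ∀ (H : V ↪ Fin n) (H' : V' ↪ Fin n),
      edgeCode loops G H ≠ edgeCode loops G' H' := fun H H' h =>
    not_isEmpty_iff.2 (nonempty_iso_of_edgeCode_eq hG hG' H.injective H'.injective h) h_iso
  let S : Finset (Vec (n * n)) := Finset.univ.image fun H : V ↪ Fin n => edgeCode loops G H
  let S' : Finset (Vec (n * n)) := Finset.univ.image fun H : V' ↪ Fin n => edgeCode loops G' H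
  obtain ⟨f, hf, hfS⟩ := exists_isMLP_eqOn (S ∪ S')
    fun x => (fun _ => if x ∈ S then 1 else 0 : Vec 1)
  refine ⟨⟨n * n, hashNet n F (edgeHead n), fun s => s.sum, f⟩,
    ⟨isNeural_hashNet F (isMLP_edgeHead n), .sum, hf⟩, fun X X' H H' hH hH' => ?_⟩
  have hHS : edgeCode loops G H ∈ S := Finset.mem_image.2 ⟨⟨H, hH⟩, Finset.mem_univ _, rfl⟩
  have hHS' : edgeCode loops G' H' ∈ S' := Finset.mem_image.2 ⟨⟨H', hH'⟩, Finset.mem_univ _, rfl⟩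
  have hHS'_notMem : edgeCode loops G' H' ∉ S := fun h => by
    obtain ⟨K, -, hK⟩ := Finset.mem_image.1 h
    exact h_code_ne K ⟨H', hH'⟩ hK
  simp only [BloomGraphNet.output, hG.sum_pair_hashNet_edgeHead hH,
    hG'.sum_pair_hashNet_edgeHead hH', hfS _ (Finset.mem_union_left _ hHS),
    hfS _ (Finset.mem_union_right _ hHS'), if_pos hHS, if_neg hHS'_notMem]
  exact one_ne_zero

end HashNet

/-! ### The graphs of the theorem -/

section Examples

instance : DecidableRel cubicGraph.Adj := fun a b =>
  decidable_of_iff _ (SimpleGraph.fromRel_adj _ a b).symm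

instance : DecidableRel shrikhande.Adj := fun a b =>
  decidable_of_iff _ (SimpleGraph.fromRel_adj _ a b).symm

instance : DecidableRel rook.Adj := fun a b =>
  decidable_of_iff _ (SimpleGraph.fromRel_adj _ a b).symm

theorem isRegularOfDegree_cubicGraph : cubicGraph.IsRegularOfDegree 3 := by
  unfold SimpleGraph.IsRegularOfDegree
  decide

theorem ncard_neighborSet_cubicGraph (v : Fin 8) : (cubicGraph.neighborSet v).ncard = 3 := by
  rw [Set.ncard_eq_toFinset_card', ← SimpleGraph.neighborFinset_def,
    SimpleGraph.card_neighborFinset_eq_degree, isRegularOfDegree_cubicGraph v]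

theorem autNodes_cubicGraph_three_six : AutNodes cubicGraph 3 6 :=
  ⟨⟨Equiv.subLeft 1, by decide⟩, rfl⟩

theorem not_autPairs_cubicGraph : ¬AutPairs cubicGraph (0, 3) (0, 6) := by
  rintro ⟨π, h₀, h₃⟩
  have h_adj : cubicGraph.Adj (π 0) (π 3) := by
    rw [h₀, h₃]
    decide
  exact absurd (π.map_adj_iff.1 h_adj) (by decide)

theorem isSRGWith_shrikhande : shrikhande.IsSRGWith 16 6 2 2 where
  card := rfl
  regular := by unfold SimpleGraph.IsRegularOfDegree; decide +kernel
  of_adj := by decide +kernel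
  of_not_adj := by unfold Pairwise; decide +kernel

theorem isSRGWith_rook : rook.IsSRGWith 16 6 2 2 where
  card := rfl
  regular := by unfold SimpleGraph.IsRegularOfDegree; decide +kernel
  of_adj := by decide +kernel
  of_not_adj := by unfold Pairwise; decide +kernel

theorem cliqueFree_four_shrikhande : shrikhande.CliqueFree 4 := by
  have h : ∀ a b, shrikhande.Adj a b → ∀ c, shrikhande.Adj a c → shrikhande.Adj b c →
      ∀ d, shrikhande.Adj a d → shrikhande.Adj b d → ¬shrikhande.Adj c d := by decide +kernel
  rw [SimpleGraph.cliqueFree_iff]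
  refine ⟨fun f => ?_⟩
  have hf : ∀ {i j}, i ≠ j → shrikhande.Adj (f i) (f j) := fun hij => f.toHom.map_adj hij
  exact h (f 0) (f 1) (hf (by decide)) (f 2) (hf (by decide)) (hf (by decide)) (f 3)
    (hf (by decide)) (hf (by decide)) (hf (by decide))

theorem not_cliqueFree_four_rook : ¬rook.CliqueFree 4 := by
  have h_row : rook.IsNClique 4 (Finset.univ.image fun j => (0, j)) := by
    rw [SimpleGraph.isNClique_iff]
    decide
  exact h_row.not_cliqueFree

theorem isEmpty_iso_shrikhande_rook : IsEmpty (shrikhande ≃g rook) :=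
  ⟨fun π => not_cliqueFree_four_rook (cliqueFree_four_shrikhande.comap π.symm.isContained)⟩

theorem nbhdAntichain_cubicGraph (loops : Bool) : NbhdAntichain loops cubicGraph := by
  unfold NbhdAntichain
  simp only [Finset.subset_iff, mem_nbhd]
  revert loops
  decide +kernel

theorem nbhdAntichain_shrikhande (loops : Bool) : NbhdAntichain loops shrikhande := by
  unfold NbhdAntichain
  simp only [Finset.subset_iff, mem_nbhd]
  revert loops
  decide +kernel

theorem nbhdAntichain_rook (loops : Bool) : NbhdAntichain loops rook := by
  unfold NbhdAntichain
  simp only [Finset.subset_iff, mem_nbhd]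
  revert loops
  decide +kernel

end Examples

end BloomMPNN

end

theorem mainTheorem4 (loops : Bool) (n F : ℕ) :
    -- every standard MPNN is an MPNN with Bloom signatures
    (∀ M : MPNN F, ∃ B : BloomNet n F 1, (M.IsNeural → B.IsNeural) ∧
      ∀ (V : Type) [Fintype V] (G : SimpleGraph V) (X : V → Vec F) (H : V → Fin n)
        (u v : V), B.score loops G X H u v = M.score loops G X u v) ∧
    -- node pairs that 1-WL tells apart are told apart
    (∀ (V V' : Type) [Fintype V] [Fintype V'] (G : SimpleGraph V) (G' : SimpleGraph V')
      (X : V → Vec F) (X' : V' → Vec F) (e : V × V) (e' : V' × V'),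
      WL1Separates G X e G' X' e' →
      ∃ B : BloomNet n F 1, B.IsNeural ∧
        ∀ (H : V → Fin n) (H' : V' → Fin n),
          B.score loops G X H e.1 e.2 ≠ B.score loops G' X' H' e'.1 e'.2) ∧
    -- the pairs (v₁, v₄), (v₁, v₇) of the 3-regular graph: non-automorphic, automorphic endpoints
    (∀ v, (cubicGraph.neighborSet v).ncard = 3) ∧
    AutNodes cubicGraph 0 0 ∧
    AutNodes cubicGraph 3 6 ∧
    ¬ AutPairs cubicGraph (0, 3) (0, 6) ∧
    -- neither 1-WL nor any standard MPNN separates them ...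
    (∀ x : Vec F,
      ¬ WL1Separates cubicGraph (fun _ => x) (0, 3)
        cubicGraph (fun _ => x) (0, 6) ∧
      ∀ M : MPNN F, M.score loops cubicGraph (fun _ => x) 0 3 =
        M.score loops cubicGraph (fun _ => x) 0 6) ∧
    -- ... but an MPNN with Bloom signatures does, for all hash functions without collisions
    (∃ B : BloomNet n F 1, B.IsNeural ∧
      ∀ (x : Vec F) (H H' : Fin 8 → Fin n), H.Injective → H'.Injective →
        B.score loops cubicGraph (fun _ => x) H 0 3 ≠
          B.score loops cubicGraph (fun _ => x) H' 0 6) ∧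
    -- 3-WL does not distinguish the non-isomorphic Shrikhande and Rook's graphs ...
    IsEmpty (shrikhande ≃g rook) ∧
    WLEquiv 3 shrikhande rook ∧
    -- ... but an MPNN with Bloom signatures does
    (∃ B : BloomGraphNet n F, B.IsNeural ∧
      ∀ (x : Vec F) (H : ZMod 4 × ZMod 4 → Fin n) (H' : Fin 4 × Fin 4 → Fin n),
        H.Injective → H'.Injective →
        B.output loops shrikhande (fun _ => x) H ≠
          B.output loops rook (fun _ => x) H') := by
  refine ⟨fun M => ⟨M.toBloom n, fun hM => hM.toBloom n, fun V _ G X H u v =>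
      M.score_toBloom loops G X H u v⟩,
    fun V V' _ _ G G' X X' e e' h => h.exists_bloomNet_score_ne loops n,
    ncard_neighborSet_cubicGraph, ⟨.refl, rfl⟩, autNodes_cubicGraph_three_six,
    not_autPairs_cubicGraph, fun x => ?_, ?_, isEmpty_iso_shrikhande_rook,
    wlEquiv_three_of_isSRGWith isSRGWith_shrikhande isSRGWith_rook, ?_⟩
  · have h_wl1 := not_wl1Separates_const_of_isRegularOfDegree isRegularOfDegree_cubicGraph
      isRegularOfDegree_cubicGraph x (0, 3) (0, 6)
    exact ⟨h_wl1, fun M => MPNN.score_eq_of_not_wl1Separates h_wl1 M loops⟩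
  · obtain ⟨B, hB, h_ne⟩ := exists_bloomNet_score_ne_of_mem_nbhd loops n F
    have h_mem : (0 : Fin 8) ∈ nbhd loops cubicGraph 6 := mem_nbhd.2 (.inl (by decide))
    have h_notMem : (0 : Fin 8) ∉ nbhd loops cubicGraph 3 := by
      rw [mem_nbhd]
      cases loops <;> decide
    exact ⟨B, hB, fun x H H' hH hH' => (h_ne _ _ _ _ (nbhdAntichain_cubicGraph loops)
      (nbhdAntichain_cubicGraph loops) _ _ H' H hH' hH h_mem h_notMem).symm⟩
  · have : Fact (1 < 4) := ⟨by decide⟩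
    obtain ⟨B, hB, h_ne⟩ := exists_bloomGraphNet_output_ne n F (nbhdAntichain_shrikhande loops)
      (nbhdAntichain_rook loops) isEmpty_iso_shrikhande_rook
    exact ⟨B, hB, fun _ => h_ne _ _⟩
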